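/- Let $A(1),A(2),\dots$ be random variables on a probability space with a filtration $(\mathcal F_t)_{t\ge0}$, and consider the controlled queue on $[0,\infty)$ \[ X(t+1)=X(t)-U(t)+A(t+1),\qquad X(0)=x\ge 0, \] where a control is a sequence $U=(U(t))_{t\ge0}$ adapted to $(\mathcal F_t)$ with $0\le U(t)\le X(t)$ almost surely. The one-step cost is $c(x,u)=x+\tfrac12u^2$. For $h:[0,\infty)\to\mathbb R$ put $\mathcal D_uh(x)=\mathsf E[h(x-u+A(1))-h(x)]$, $0\le u\le x$. **Assumption A1.** Each $A(t+1)$ is $\mathcal F_{t+1}$-measurable, independent of $\mathcal F_t$ and distributed as $A(1)$ (so the arrivals are i.i.d.); $A(1)\ge0$ almost surely, with mean $\alpha$; $\mathsf P\{A(1)=0\}>0$; and $\mathsf P\{A(1)<N\}=1$ for some constant $N>0$. Let \[ K^*(x)=\alpha x+\tfrac13\bigl[(2x+\alpha^2)^{3/2}-\alpha^3\bigr],\qquad \mathcal E_B(x)=\min_{0\le u\le x}\bigl(c(x,u)+\mathcal D_uK^*(x)\bigr),\qquad x\ge0 . \] Let $\eta^*\in[0,\infty)$ be the optimal average cost, assumed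 finite and independent of $x$: for every $x\ge0$, \[ \eta^*=\inf_U\limsup_{n\to\infty}\frac1n\sum_{t=0}^{n-1}\mathsf E_x[c(X(t),U(t))]. \] Let the relative value function $h^*:[0,\infty)\to\mathbb R$ be measurable, with $\mathsf E|h^*(y+A(1))|<\infty$ for all $y\ge0$, and solve the optimality equation $\min_{0\le u\le x}(c(x,u)+\mathcal D_uh^*(x))=\eta^*$ for all $x\ge0$. Let the optimal policy $\phi^*$ be a measurable selection of minimizers in this equation. Write $\tau_0=\min\{t\ge1:X(t)=0\}$. **Assumption A2.** For every $x\ge0$, \[ h^*(x)=\min_U\mathsf E_x\Bigl[\sum_{t=0}^{\tau_0-1}\bigl(c(X(t),U(t))-\eta^*\bigr)\Bigr], \] the minimum being over controls with $\mathsf E_x[\tau_0]<\infty$. Moreover, for each integer $N\ge1$ there are $T<\infty$ and $\varepsilon>0$ such that, under $\phi^*$, $\mathsf P\{X(t)=0\mid X(0)=x\}\ge\varepsilon$ whenever $0\le x\le N$ and $t\ge T$. **Proposition.** (i) Under A1, the minimum defining $\mathcal E_B(x)$ is attained and $\mathcal E_B(x)\ge0$ for all $x\ge0$, and \[ \lim_{x\to\infty}\frac{\mathcal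 E_B(x)}{\sqrt x}=\frac1{\sqrt2}, \qquad\text{so that}\qquad \lim_{x\to\infty}\frac{\mathcal E_B(x)}{c(x,0)}=0 . \] (ii) Under A1 and A2, the direct error $\mathcal E_d(x)=h^*(x)-K^*(x)$ is bounded below by a constant and above by a function of at most linear growth: there are constants $b_0,b_1,b_2$ such that \[ -b_0\le\mathcal E_d(x)\le b_1x+b_2\qquad\text{for all }x\ge0 . \] In particular $\displaystyle\lim_{x\to\infty}\frac{\mathcal E_d(x)}{K^*(x)}=0$. -/

import Mathlib

open MeasureTheory ProbabilityTheory Filter Topology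
open scoped ENNReal

namespace SpeedScaling

noncomputable section

/-- The one-step cost `c(x,u) = x + u²/2`. -/
def cost (x u : ℝ) : ℝ := x + u ^ 2 / 2

/-- The fluid value function `K*(x) = α x + ((2x + α²)^{3/2} - α³)/3`. -/
def fluidValue (α x : ℝ) : ℝ :=
  α * x + ((2 * x + α ^ 2) ^ (3 / 2 : ℝ) - α ^ 3) / 3

variable {Ω : Type*} [mΩ : MeasurableSpace Ω]

/-- The standing assumption on the arrivals `A(1), A(2), …` (the value `A 0` is never used).
The information available at time `t` is `ℱ t`; each `A(t+1)` is `ℱ (t+1)`-measurable, independent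
of `ℱ t`, and distributed as `A(1)`, so that the arrivals are i.i.d. For the natural filtration of
the arrivals this says no more than i.i.d.; a larger `ℱ` allows for randomized controls. -/
structure AssumptionA1 (P : Measure Ω) (ℱ : Filtration ℕ mΩ) (A : ℕ → Ω → ℝ) : Prop where
  measurable : ∀ t, Measurable[ℱ (t + 1)] (A (t + 1))
  indep : ∀ t, Indep (MeasurableSpace.comap (A (t + 1)) inferInstance) (ℱ t) P
  identDistrib : ∀ t, IdentDistrib (A (t + 1)) (A 1) P P
  nonneg : ∀ᵐ ω ∂P, 0 ≤ A 1 ω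
  zero_pos : 0 < P {ω | A 1 ω = 0}
  bounded : ∃ N : ℝ, 0 < N ∧ P {ω | A 1 ω < N} = 1

/-- The mean `α = E[A(1)]`. -/
def meanArrival (P : Measure Ω) (A : ℕ → Ω → ℝ) : ℝ := ∫ ω, A 1 ω ∂P

/-- The generator `𝒟_u h (x) = E[h(X(t+1)) - h(X(t)) | X(t) = x, U(t) = u]`. -/
def generator (P : Measure Ω) (A : ℕ → Ω → ℝ) (h : ℝ → ℝ) (u x : ℝ) : ℝ :=
  ∫ ω, (h (x - u + A 1 ω) - h x) ∂P

/-- The values `c(x,u) + 𝒟_u h (x)` over the feasible set `U(x) = [0,x]`. -/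
def bellmanValues (P : Measure Ω) (A : ℕ → Ω → ℝ) (h : ℝ → ℝ) (x : ℝ) : Set ℝ :=
  (fun u => cost x u + generator P A h u x) '' Set.Icc 0 x

/-- The Bellman error `E_B(x) = min_{0 ≤ u ≤ x} (c(x,u) + 𝒟_u h (x))`. -/
def bellmanError (P : Measure Ω) (A : ℕ → Ω → ℝ) (h : ℝ → ℝ) (x : ℝ) : ℝ :=
  sInf (bellmanValues P A h x)

/-- The state process `X(0) = x`, `X(t+1) = X(t) - U(t) + A(t+1)`. -/
def state (A U : ℕ → Ω → ℝ) (x : ℝ) : ℕ → Ω → ℝ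
  | 0, _ => x
  | t + 1, ω => state A U x t ω - U t ω + A (t + 1) ω

/-- The state process under the stationary policy `φ`, i.e. with `U(t) = φ(X(t))`. -/
def policyState (A : ℕ → Ω → ℝ) (φ : ℝ → ℝ) (x : ℝ) : ℕ → Ω → ℝ
  | 0, _ => x
  | t + 1, ω => policyState A φ x t ω - φ (policyState A φ x t ω) + A (t + 1) ω

/-- Admissible control sequences from the initial state `x`: non-anticipative, with
`0 ≤ U(t) ≤ X(t)` almost surely. -/
structure IsControl (P : Measure Ω) (ℱ : Filtration ℕ mΩ) (A : ℕ → Ω → ℝ) (x : ℝ)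
    (U : ℕ → Ω → ℝ) : Prop where
  adapted : ∀ t, Measurable[ℱ t] (U t)
  feasible : ∀ t, ∀ᵐ ω ∂P, U t ω ∈ Set.Icc 0 (state A U x t ω)

/-- The average cost `limsup_n (1/n) ∑_{t<n} E_x[c(X(t),U(t))]`, in `[0,∞]`. -/
def averageCost (P : Measure Ω) (A U : ℕ → Ω → ℝ) (x : ℝ) : ℝ≥0∞ :=
  limsup (fun n : ℕ =>
    (∑ t ∈ Finset.range n, ∫⁻ ω, ENNReal.ofReal (cost (state A U x t ω) (U t ω)) ∂P) / n) atTop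

/-- `η` is the optimal average cost, the same for every initial state. -/
def IsOptimalAverageCost (P : Measure Ω) (ℱ : Filtration ℕ mΩ) (A : ℕ → Ω → ℝ) (η : ℝ) : Prop :=
  0 ≤ η ∧ ∀ x, 0 ≤ x →
    (⨅ (U : ℕ → Ω → ℝ) (_ : IsControl P ℱ A x U), averageCost P A U x) = ENNReal.ofReal η

/-- `h` is a relative value function with constant `η`, i.e. it solves the average cost optimality
equation `min_{0 ≤ u ≤ x} (c(x,u) + 𝒟_u h (x)) = η` for all `x ≥ 0`, and `φ` is an optimal policy,
i.e. a measurable selection of minimizers. -/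
structure IsRelativeValueFunction (P : Measure Ω) (A : ℕ → Ω → ℝ) (η : ℝ) (h φ : ℝ → ℝ) :
    Prop where
  measurable : Measurable h
  integrable : ∀ y, 0 ≤ y → Integrable (fun ω => h (y + A 1 ω)) P
  acoe : ∀ x, 0 ≤ x → IsLeast (bellmanValues P A h x) η
  policy_measurable : Measurable φ
  policy_feasible : ∀ x, 0 ≤ x → φ x ∈ Set.Icc 0 x
  policy_optimal : ∀ x, 0 ≤ x →
    IsMinOn (fun u => cost x u + generator P A h u x) (Set.Icc 0 x) (φ x)

/-- The first return time `τ₀ = min {t ≥ 1 : X(t) = 0}`, with value `∞` if there is no return. -/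
def returnTime (X : ℕ → Ω → ℝ) (ω : Ω) : ℕ∞ :=
  ⨅ (t : ℕ) (_ : 1 ≤ t ∧ X t ω = 0), (t : ℕ∞)

/-- The relative cost `∑_{t=0}^{τ₀-1} (c(X(t),U(t)) - η)` up to the first return time to `0`
(used only for controls under which the return time is almost surely finite). -/
def cycleCost (A U : ℕ → Ω → ℝ) (η x : ℝ) (ω : Ω) : ℝ :=
  ∑ t ∈ Finset.range (returnTime (state A U x) ω).toNat, (cost (state A U x t ω) (U t ω) - η)

/-- The stochastic shortest path representation with target state `0`: for each `x ≥ 0`,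
`h(x) = min_U E_x[∑_{t=0}^{τ₀-1} (c(X(t),U(t)) - η)]`. The minimum is over the controls with
`E_x[τ₀] < ∞`, for which the expectation exists in `(-∞,∞]`; controls of infinite expected cost do
not affect the minimum and are left out by the integrability requirement. -/
def HasSSPRepresentation (P : Measure Ω) (ℱ : Filtration ℕ mΩ) (A : ℕ → Ω → ℝ) (η : ℝ)
    (h : ℝ → ℝ) : Prop :=
  ∀ x, 0 ≤ x → IsLeast
    {v : ℝ | ∃ U : ℕ → Ω → ℝ, IsControl P ℱ A x U ∧
      ∫⁻ ω, (returnTime (state A U x) ω : ℝ≥0∞) ∂P < ⊤ ∧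
      Integrable (cycleCost A U η x) P ∧
      v = ∫ ω, cycleCost A U η x ω ∂P} (h x)

/-- The assumption on the relative value function `h`, the optimal average cost `η` and the optimal
policy `φ`: the stochastic shortest path representation, and smallness of bounded sets. -/
structure AssumptionA2 (P : Measure Ω) (ℱ : Filtration ℕ mΩ) (A : ℕ → Ω → ℝ) (η : ℝ)
    (h φ : ℝ → ℝ) : Prop where
  ssp : HasSSPRepresentation P ℱ A η h
  small : ∀ N : ℕ, 1 ≤ N → ∃ T : ℕ, ∃ ε : ℝ, 0 < ε ∧ ∀ x : ℝ, 0 ≤ x → x ≤ N → ∀ t : ℕ, T ≤ t →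
    ENNReal.ofReal ε ≤ P {ω | policyState A φ x t ω = 0}

end

end SpeedScaling

/-!
Write `s(x) = √(2x + α²)`. The fluid value function `K` has derivative `α + s`, solves the fluid
optimality equation `min_u (c(x,u) + (α - u) K'(x)) = 0`, and has an exact second order expansion
(`fluidValue_expansion`).

*Bellman error.* Replacing the arrival by its mean (Jensen) and completing the square bounds every
Bellman value of `K` below by `s²/(2(s+1))` (`AssumptionA1.le_cost_add_generator`); the fluid policy
`u = α + s(x)` gives the matching upper bound `(s+α+N)²/(2(s-2))` for large `x`
(`AssumptionA1.fluid_policy_le`). Both are asymptotic to `s/2`, and `s(x) ~ √2 √x`.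

*Upper bound on the direct error.* Comparing two states served down to the same level, the
optimality equation shows that `h(x) - x - x²/2` is nonincreasing, so that `h` is bounded on compact
sets. At large states the fluid policy lowers the state by at least `1`, and the mean decrease
`4s` of the linear function `4x` is at least the Bellman value of `K`; induction on the size of the state
gives `h ≤ K + 4x + B` (`IsRelativeValueFunction.exists_le_fluidValue_add`).

*Lower bound on the direct error.* At large states the Bellman error of `K` exceeds `η`, so `K`
satisfies the optimality inequality `K(x) + η ≤ c(x,u) + E[K(x-u+A)]`; at small states a shift
`h + C` dominates `K`. A maximum of subsolutions is a subsolution, so `g = max (h + C) K` satisfies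
the inequality for all feasible pairs. Along an optimal control of the stochastic shortest path
problem this gives `K(x) ≤ g(x) ≤ h(x) + g(0)` (`IsControl.verification`). The boundary term
`E[g(X(n)); τ₀ > n]` vanishes in the limit: `g` is dominated by `1 + K₀`, with `K₀` the fluid value
function for zero arrival rate, and along every path `K₀(X(n))` is at most the cost still to be paid
until `τ₀`, whose expectation is the tail of a convergent series
(`IsControl.ae_fluidValue_le_tsum`).
-/

namespace SpeedScaling

/-! ### The fluid value function -/

/-- The quantity `s(x) = √(2x + α²)`, so that the fluid value function has derivative `α + s(x)`. -/
noncomputable def fluidSlope (α x : ℝ) : ℝ := √(2 * x + α ^ 2)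

lemma fluidSlope_nonneg (α x : ℝ) : 0 ≤ fluidSlope α x := Real.sqrt_nonneg _

lemma fluidSlope_sq (α : ℝ) {x : ℝ} (hx : 0 ≤ x) : fluidSlope α x ^ 2 = 2 * x + α ^ 2 :=
  Real.sq_sqrt (by positivity)

lemma fluidValue_eq (α : ℝ) {x : ℝ} (hx : 0 ≤ x) :
    fluidValue α x = α * x + (fluidSlope α x ^ 3 - α ^ 3) / 3 := by
  have h : (2 * x + α ^ 2) ^ (3 / 2 : ℝ) = fluidSlope α x ^ 3 := by
    rw [fluidSlope, Real.sqrt_eq_rpow, ← Real.rpow_natCast (_ ^ (1 / 2 : ℝ)),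
      ← Real.rpow_mul (by positivity)]
    norm_num
  rw [fluidValue, h]

lemma continuous_fluidValue (α : ℝ) : Continuous (fluidValue α) := by
  unfold fluidValue
  exact (continuous_const.mul continuous_id).add
    (((Continuous.rpow_const (by fun_prop) fun _ => Or.inr (by norm_num)).sub
      continuous_const).div_const _)

/-- The exact second order expansion of the fluid value function. -/
lemma fluidValue_expansion (α : ℝ) {x y : ℝ} (hx : 0 ≤ x) (hy : 0 ≤ y) :
    fluidValue α y = fluidValue α x + (α + fluidSlope α x) * (y - x)
      + (fluidSlope α y - fluidSlope α x) ^ 2 * (2 * fluidSlope α y + fluidSlope α x) / 6 := by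
  rw [fluidValue_eq α hx, fluidValue_eq α hy]
  have h1 := fluidSlope_sq α hx
  have h2 := fluidSlope_sq α hy
  generalize fluidSlope α x = s at *
  generalize fluidSlope α y = t at *
  obtain rfl : x = (s ^ 2 - α ^ 2) / 2 := by linarith
  obtain rfl : y = (t ^ 2 - α ^ 2) / 2 := by linarith
  ring

/-- The fluid value function lies above its tangents. -/
lemma fluidValue_tangent_le (α : ℝ) {x y : ℝ} (hx : 0 ≤ x) (hy : 0 ≤ y) :
    fluidValue α x + (α + fluidSlope α x) * (y - x) ≤ fluidValue α y := by
  rw [fluidValue_expansion α hx hy]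
  have := fluidSlope_nonneg α x
  have := fluidSlope_nonneg α y
  have : 0 ≤ (fluidSlope α y - fluidSlope α x) ^ 2 * (2 * fluidSlope α y + fluidSlope α x) / 6 := by
    positivity
  linarith

lemma fluidValue_zero {α : ℝ} (hα : 0 ≤ α) : fluidValue α 0 = 0 := by
  rw [fluidValue_eq α le_rfl]
  have : fluidSlope α 0 = α := by simp [fluidSlope, Real.sqrt_sq hα]
  rw [this]; ring

lemma fluidValue_mono {α x y : ℝ} (hα : 0 ≤ α) (hx : 0 ≤ x) (hxy : x ≤ y) :
    fluidValue α x ≤ fluidValue α y := by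
  have h := fluidValue_tangent_le α hx (hx.trans hxy)
  have h0 : 0 ≤ (α + fluidSlope α x) * (y - x) :=
    mul_nonneg (add_nonneg hα (fluidSlope_nonneg α x)) (sub_nonneg.2 hxy)
  linarith

lemma fluidValue_nonneg {α x : ℝ} (hα : 0 ≤ α) (hx : 0 ≤ x) : 0 ≤ fluidValue α x :=
  (fluidValue_zero hα).symm.le.trans (fluidValue_mono hα le_rfl hx)

lemma le_fluidSlope {α x : ℝ} (hx : 0 ≤ x) : α ≤ fluidSlope α x :=
  Real.le_sqrt_of_sq_le (by linarith)

lemma tendsto_fluidSlope (α : ℝ) : Tendsto (fluidSlope α) atTop atTop := by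
  unfold fluidSlope
  refine Real.tendsto_sqrt_atTop.comp (tendsto_atTop_add_const_right _ _ ?_)
  exact tendsto_id.const_mul_atTop (by norm_num)

/-- The fluid value function for zero arrival rate bounds the one for rate `α` from below. -/
lemma sqrt_cube_le_fluidValue {α x : ℝ} (hα : 0 ≤ α) (hx : 0 ≤ x) :
    √(2 * x) ^ 3 / 3 ≤ fluidValue α x := by
  rw [fluidValue_eq α hx]
  have h1 := fluidSlope_sq α hx
  have h2 : √(2 * x) ^ 2 = 2 * x := Real.sq_sqrt (by positivity)
  have h3 := le_fluidSlope (α := α) hx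
  have h4 := Real.sqrt_nonneg (2 * x)
  have h5 : √(2 * x) ≤ fluidSlope α x := Real.sqrt_le_sqrt (by nlinarith)
  generalize fluidSlope α x = s at *
  generalize √(2 * x) = r at *
  have h6 : s ^ 3 = s * r ^ 2 + s * α ^ 2 := by rw [← mul_add, h2, ← h1]; ring
  have h7 : r * r ^ 2 ≤ s * r ^ 2 := by gcongr
  have h8 : α * α ^ 2 ≤ s * α ^ 2 := by gcongr
  have h9 : 0 ≤ α * x := by positivity
  nlinarith

/-- The fluid value function for rate `α`, plus any affine function, is dominated by a multiple of
one plus the fluid value function for zero arrival rate. -/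
lemma exists_fluidValue_add_affine_le {α b c : ℝ} (hα : 0 ≤ α) (hb : 0 ≤ b) (hc : 0 ≤ c) :
    ∃ D : ℝ, 0 ≤ D ∧ ∀ x, 0 ≤ x →
      fluidValue α x + b * x + c ≤ D * (1 + fluidValue 0 x) := by
  refine ⟨3 * (α / 2 + 1 / 3 + α + α ^ 2 + b / 2 + c), by positivity, fun x hx => ?_⟩
  have h0 : fluidValue 0 x = √(2 * x) ^ 3 / 3 := by
    rw [fluidValue_eq 0 hx]; simp [fluidSlope]
  rw [fluidValue_eq α hx, h0]
  have h2 : √(2 * x) ^ 2 = 2 * x := Real.sq_sqrt (by positivity)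
  have h4 := Real.sqrt_nonneg (2 * x)
  have h5 : fluidSlope α x ≤ √(2 * x) + α := by
    refine Real.sqrt_le_iff.2 ⟨by positivity, ?_⟩
    nlinarith [mul_nonneg h4 hα]
  have h6 : fluidSlope α x ^ 3 ≤ (√(2 * x) + α) ^ 3 :=
    pow_le_pow_left₀ (fluidSlope_nonneg α x) h5 3
  generalize fluidSlope α x = s at *
  generalize √(2 * x) = r at *
  obtain rfl : x = r ^ 2 / 2 := by linarith
  have hr2 : r ^ 2 ≤ 1 + r ^ 3 := by
    rcases le_total r 1 with h | h
    · nlinarith [pow_nonneg h4 3]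
    · nlinarith [mul_nonneg (sub_nonneg.2 h) (sq_nonneg r)]
  have hr1 : r ≤ 1 + r ^ 3 := by
    rcases le_total r 1 with h | h
    · nlinarith [pow_nonneg h4 3]
    · nlinarith [mul_nonneg (sub_nonneg.2 h) (sq_nonneg r), mul_nonneg (sub_nonneg.2 h) h4]
  have hr3 : 0 ≤ r ^ 3 := pow_nonneg h4 3
  have e1 : α * r ^ 2 ≤ α * (1 + r ^ 3) := by gcongr
  have e2 : α ^ 2 * r ≤ α ^ 2 * (1 + r ^ 3) := by gcongr
  have e3 : b * r ^ 2 ≤ b * (1 + r ^ 3) := by gcongr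
  have e4 : 0 ≤ c * r ^ 3 := by positivity
  have e5 : 0 ≤ α * r ^ 3 := by positivity
  have e6 : 0 ≤ α ^ 2 * r ^ 3 := by positivity
  have e7 : 0 ≤ b * r ^ 3 := by positivity
  nlinarith [sq_nonneg α]

/-! ### The Bellman error of the fluid value function -/

/-- Completing the square in the fluid optimality equation. -/
lemma cost_add_fluid_drift (α u : ℝ) {x : ℝ} (hx : 0 ≤ x) :
    cost x u + (α + fluidSlope α x) * (α - u) = (u - α - fluidSlope α x) ^ 2 / 2 := by
  have h := fluidSlope_sq α hx
  unfold cost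
  nlinarith

/-- The deterministic lower bound behind the growth of the Bellman error, in the variables
`s = s(x)` and `t = s(x - u + α)`. The minimum over `w` of `(w - s)²/2 + w²/(2s)` is `s²/(2(s+1))`. -/
lemma sq_div_le_of_slopes {s t : ℝ} (hs : 0 ≤ s) (ht : 0 ≤ t) :
    s ^ 2 / (2 * (s + 1)) ≤
      ((s ^ 2 - t ^ 2) / 2 - s) ^ 2 / 2 + (t - s) ^ 2 * (2 * t + s) / 6 := by
  rw [div_le_iff₀ (by positivity)]
  rcases le_total t s with h | h
  · have h1 : ((s ^ 2 - t ^ 2) / 2) ^ 2 ≤ 2 * s * ((t - s) ^ 2 * (2 * t + s) / 6) := by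
      have : 0 ≤ (t - s) ^ 2 * ((s - t) * (s + 3 * t)) :=
        mul_nonneg (sq_nonneg _) (mul_nonneg (sub_nonneg.2 h) (by positivity))
      nlinarith
    have h2 : 0 ≤ (t - s) ^ 2 * (2 * t + s) / 6 := by positivity
    generalize (t - s) ^ 2 * (2 * t + s) / 6 = q at *
    generalize (s ^ 2 - t ^ 2) / 2 = w at *
    rcases hs.eq_or_lt with rfl | hs
    · nlinarith [sq_nonneg w]
    -- After multiplication by `s` the slack is the square `((s + 1) w - s²)²`.
    · refine le_of_mul_le_mul_left ?_ hs
      nlinarith [sq_nonneg ((s + 1) * w - s ^ 2), mul_nonneg hs.le h2]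
  · have h1 : s ^ 2 ≤ ((s ^ 2 - t ^ 2) / 2 - s) ^ 2 := by
      have : 0 ≤ (t ^ 2 - s ^ 2) / 2 := by nlinarith
      nlinarith
    have h2 : 0 ≤ (t - s) ^ 2 * (2 * t + s) / 6 := by positivity
    nlinarith [sq_nonneg s, mul_nonneg hs (sq_nonneg s), mul_nonneg hs (sub_nonneg.2 h1),
      mul_nonneg hs h2]

variable {Ω : Type*} [mΩ : MeasurableSpace Ω] {P : Measure Ω}
  {ℱ : Filtration ℕ mΩ} {A : ℕ → Ω → ℝ}

namespace AssumptionA1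

lemma measurable_arrival (hA : AssumptionA1 P ℱ A) (t : ℕ) : Measurable (A (t + 1)) :=
  (hA.measurable t).mono (ℱ.le _) le_rfl

lemma meanArrival_nonneg (hA : AssumptionA1 P ℱ A) : 0 ≤ meanArrival P A :=
  integral_nonneg_of_ae hA.nonneg

variable [IsProbabilityMeasure P]

lemma exists_bound (hA : AssumptionA1 P ℱ A) :
    ∃ N : ℝ, 0 < N ∧ ∀ᵐ ω ∂P, A 1 ω ∈ Set.Icc 0 N := by
  obtain ⟨N, hN, h⟩ := hA.bounded
  refine ⟨N, hN, ?_⟩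
  have h' : ∀ᵐ ω ∂P, A 1 ω < N :=
    (prob_compl_eq_zero_iff (measurableSet_lt (hA.measurable_arrival 0) measurable_const)).2 h
  filter_upwards [hA.nonneg, h'] with ω h1 h2 using ⟨h1, h2.le⟩

/-- A function that is bounded on compact sets is integrable along one step of the queue. -/
lemma integrable_comp (hA : AssumptionA1 P ℱ A) {f : ℝ → ℝ} (hf : Measurable f)
    (hb : ∀ R : ℝ, ∃ C, ∀ y ∈ Set.Icc 0 R, |f y| ≤ C) {z : ℝ} (hz : 0 ≤ z) :
    Integrable (fun ω => f (z + A 1 ω)) P := by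
  obtain ⟨N, hN, hbd⟩ := hA.exists_bound
  obtain ⟨C, hC⟩ := hb (z + N)
  refine Integrable.of_bound
    (hf.comp (measurable_const.add (hA.measurable_arrival 0))).aestronglyMeasurable C ?_
  filter_upwards [hbd] with ω hω
  exact hC _ ⟨add_nonneg hz hω.1, by linarith [hω.2]⟩

lemma integrable_continuous (hA : AssumptionA1 P ℱ A) {f : ℝ → ℝ} (hf : Continuous f)
    {z : ℝ} (hz : 0 ≤ z) : Integrable (fun ω => f (z + A 1 ω)) P :=
  hA.integrable_comp hf.measurable
    (fun _ => isCompact_Icc.exists_bound_of_continuousOn hf.continuousOn) hz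

lemma integrable_arrival (hA : AssumptionA1 P ℱ A) : Integrable (A 1) P := by
  simpa using hA.integrable_continuous continuous_id le_rfl

lemma integrable_affine (hA : AssumptionA1 P ℱ A) (a b c : ℝ) :
    Integrable (fun ω => a + b * (A 1 ω - c)) P :=
  (integrable_const _).add ((hA.integrable_arrival.sub (integrable_const _)).const_mul _)

lemma integral_affine (hA : AssumptionA1 P ℱ A) (a b c : ℝ) :
    ∫ ω, (a + b * (A 1 ω - c)) ∂P = a + b * (meanArrival P A - c) := by
  have hi := hA.integrable_arrival.sub (integrable_const c)
  calc _ = (∫ _, a ∂P) + ∫ ω, b * (A 1 ω - c) ∂P :=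
        integral_add (integrable_const _) (hi.const_mul _)
    _ = a + b * ((∫ ω, A 1 ω ∂P) - ∫ _, c ∂P) := by
        rw [integral_const_mul, integral_sub hA.integrable_arrival (integrable_const _)]
        simp
    _ = _ := by simp [meanArrival]

end AssumptionA1

variable [IsProbabilityMeasure P]

lemma generator_eq {h : ℝ → ℝ} {u x : ℝ} (hi : Integrable (fun ω => h (x - u + A 1 ω)) P) :
    generator P A h u x = (∫ ω, h (x - u + A 1 ω) ∂P) - h x := by
  rw [generator, integral_sub hi (integrable_const _)]
  simp

/-- Every Bellman value of the fluid value function is at least `s²/(2(s+1))`: by Jensen's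
inequality the arrival may be replaced by its mean. -/
lemma AssumptionA1.le_cost_add_generator (hA : AssumptionA1 P ℱ A) {x u : ℝ}
    (hu : u ∈ Set.Icc 0 x) :
    fluidSlope (meanArrival P A) x ^ 2 / (2 * (fluidSlope (meanArrival P A) x + 1)) ≤
      cost x u + generator P A (fluidValue (meanArrival P A)) u x := by
  have hα := hA.meanArrival_nonneg
  set α := meanArrival P A with hαdef
  have hx : 0 ≤ x := hu.1.trans hu.2
  have hz : 0 ≤ x - u := sub_nonneg.2 hu.2
  have hm : 0 ≤ x - u + α := add_nonneg hz hα
  have hint := hA.integrable_continuous (continuous_fluidValue α) hz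
  rw [generator_eq hint]
  have hJ : fluidValue α (x - u + α) ≤ ∫ ω, fluidValue α (x - u + A 1 ω) ∂P := by
    -- The expectation of the tangent at the mean `x - u + α` is its value at the mean.
    have e := hA.integral_affine (fluidValue α (x - u + α)) (α + fluidSlope α (x - u + α)) α
    rw [← hαdef, sub_self, mul_zero, add_zero] at e
    rw [← e]
    refine integral_mono_ae (hA.integrable_affine _ _ _) hint ?_
    · filter_upwards [hA.nonneg] with ω hω
      have := fluidValue_tangent_le α hm (add_nonneg hz hω)
      calc _ = fluidValue α (x - u + α) + (α + fluidSlope α (x - u + α)) *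
            (x - u + A 1 ω - (x - u + α)) := by ring
        _ ≤ _ := this
  have h1 := fluidValue_expansion α hx hm
  have h2 := cost_add_fluid_drift α u hx
  have h3 := sq_div_le_of_slopes (fluidSlope_nonneg α x) (fluidSlope_nonneg α (x - u + α))
  have h4 : (fluidSlope α x ^ 2 - fluidSlope α (x - u + α) ^ 2) / 2 = u - α := by
    rw [fluidSlope_sq α hx, fluidSlope_sq α hm]; ring
  rw [h4] at h3
  linarith

/-- Upper bound for the second order term of the fluid value function over one step. -/
lemma fluidValue_remainder_le {s t q w : ℝ} (hq : 0 < q) (hqs : q ≤ s) (hqt : q ≤ t)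
    (hw : ((s ^ 2 - t ^ 2) / 2) ^ 2 ≤ w ^ 2) :
    (t - s) ^ 2 * (2 * t + s) / 6 ≤ w ^ 2 / (2 * q) := by
  rw [le_div_iff₀ (by positivity)]
  refine le_trans ?_ hw
  have hs := hq.trans_le hqs
  have ht := hq.trans_le hqt
  have h1 : 4 * (2 * t + s) * q ≤ 3 * (t + s) ^ 2 := by
    rcases le_total t s with h | h
    · nlinarith [mul_nonneg (sub_nonneg.2 hqt) (by positivity : 0 ≤ 2 * t + s)]
    · nlinarith [mul_nonneg (sub_nonneg.2 hqs) (by positivity : 0 ≤ 2 * t + s)]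
  nlinarith [mul_le_mul_of_nonneg_left h1 (sq_nonneg (t - s))]

/-- The fluid policy `u = α + s(x)` is feasible for large `x`, and its Bellman value is at most
`(s + α + N)²/(2(s - 2))`. -/
lemma AssumptionA1.fluid_policy_le (hA : AssumptionA1 P ℱ A) {N : ℝ} (hN : 0 < N)
    (hbd : ∀ᵐ ω ∂P, A 1 ω ∈ Set.Icc 0 N) {x : ℝ} (hx : 0 ≤ x)
    (hs : 3 + meanArrival P A ≤ fluidSlope (meanArrival P A) x) :
    meanArrival P A + fluidSlope (meanArrival P A) x ∈ Set.Icc 0 x ∧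
    cost x (meanArrival P A + fluidSlope (meanArrival P A) x) +
      generator P A (fluidValue (meanArrival P A))
        (meanArrival P A + fluidSlope (meanArrival P A) x) x ≤
      (fluidSlope (meanArrival P A) x + meanArrival P A + N) ^ 2 /
        (2 * (fluidSlope (meanArrival P A) x - 2)) := by
  have hα := hA.meanArrival_nonneg
  set α := meanArrival P A with hαdef
  have hsq := fluidSlope_sq α hx
  set s := fluidSlope α x with hsdef
  have hux : α + s ≤ x := by nlinarith
  refine ⟨⟨by linarith, hux⟩, ?_⟩
  have hz : 0 ≤ x - (α + s) := sub_nonneg.2 hux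
  have hgen : generator P A (fluidValue α) (α + s) x ≤
      ∫ ω, ((s + α + N) ^ 2 / (2 * (s - 2)) + (α + s) * (A 1 ω - (α + s))) ∂P := by
    refine integral_mono_ae
      ((hA.integrable_continuous (continuous_fluidValue α) hz).sub (integrable_const _))
      (hA.integrable_affine _ _ _) ?_
    filter_upwards [hbd] with ω hω
    have hy : 0 ≤ x - (α + s) + A 1 ω := add_nonneg hz hω.1
    have hexp := fluidValue_expansion α hx hy
    have hty := fluidSlope_sq α hy
    -- Since `s(x - u)² = s² - 2(α + s)`, this is where `s ≥ 3 + α` enters.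
    have hq : s - 2 ≤ fluidSlope α (x - (α + s) + A 1 ω) := by
      refine Real.le_sqrt_of_sq_le ?_
      nlinarith [hω.1]
    have hrem := fluidValue_remainder_le (s := s) (q := s - 2) (w := s + α + N)
      (by linarith) (by linarith) hq (by
        rw [hty, hsq]
        refine sq_le_sq' ?_ ?_ <;> linarith [hω.1, hω.2])
    rw [← hsdef] at hexp
    calc _ = (α + s) * (x - (α + s) + A 1 ω - x) + (fluidSlope α (x - (α + s) + A 1 ω) - s) ^ 2 *
          (2 * fluidSlope α (x - (α + s) + A 1 ω) + s) / 6 := by rw [hexp]; ring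
      _ ≤ (α + s) * (x - (α + s) + A 1 ω - x) + (s + α + N) ^ 2 / (2 * (s - 2)) := by gcongr
      _ = _ := by ring
  rw [hA.integral_affine, ← hαdef] at hgen
  have h2 := cost_add_fluid_drift α (α + s) hx
  rw [← hsdef] at h2
  have h3 : (α + s - α - s) ^ 2 / 2 = 0 := by ring
  rw [h3] at h2
  linarith

/-- The Bellman values depend continuously on the control, so the minimum is attained. -/
lemma AssumptionA1.isLeast_bellmanError (hA : AssumptionA1 P ℱ A) {f : ℝ → ℝ} (hf : Continuous f)
    {x : ℝ} (hx : 0 ≤ x) : IsLeast (bellmanValues P A f x) (bellmanError P A f x) := by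
  have hcont : ContinuousOn (fun u => cost x u + generator P A f u x) (Set.Icc 0 x) := by
    refine ContinuousOn.add (by unfold cost; fun_prop) ?_
    obtain ⟨N, hN, hbd⟩ := hA.exists_bound
    obtain ⟨C, hC⟩ := isCompact_Icc.exists_bound_of_continuousOn
      (s := Set.Icc 0 (x + N)) hf.continuousOn
    have hm := hA.measurable_arrival 0
    refine continuousOn_of_dominated (bound := fun _ => C + ‖f x‖) ?_ ?_ (integrable_const _) ?_
    · intro u _
      exact ((hf.measurable.comp (measurable_const.add hm)).sub
        measurable_const).aestronglyMeasurable
    · intro u hu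
      filter_upwards [hbd] with ω hω
      refine (norm_sub_le _ _).trans (add_le_add_left (hC _ ⟨?_, ?_⟩) _)
      · linarith [hu.2, hω.1]
      · linarith [hu.1, hω.2]
    · exact Eventually.of_forall fun ω => by fun_prop
  obtain ⟨u, hu, hmin⟩ := isCompact_Icc.exists_isMinOn (Set.nonempty_Icc.2 hx) hcont
  have hl : IsLeast (bellmanValues P A f x) (cost x u + generator P A f u x) :=
    ⟨⟨u, hu, rfl⟩, by rintro _ ⟨v, hv, rfl⟩; exact hmin hv⟩
  rw [bellmanError, hl.csInf_eq]
  exact hl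

lemma AssumptionA1.le_bellmanError (hA : AssumptionA1 P ℱ A) {x : ℝ} (hx : 0 ≤ x) :
    fluidSlope (meanArrival P A) x ^ 2 / (2 * (fluidSlope (meanArrival P A) x + 1)) ≤
      bellmanError P A (fluidValue (meanArrival P A)) x := by
  obtain ⟨u, hu, h⟩ := (hA.isLeast_bellmanError (continuous_fluidValue (meanArrival P A)) hx).1
  rw [← h]
  exact hA.le_cost_add_generator hu

lemma tendsto_fluidSlope_div_sqrt (α : ℝ) :
    Tendsto (fun x => fluidSlope α x / √x) atTop (𝓝 √2) := by
  have h : Tendsto (fun x : ℝ => √(2 + α ^ 2 / x)) atTop (𝓝 √(2 + 0)) :=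
    (Real.continuous_sqrt.tendsto _).comp
      (tendsto_const_nhds.add (tendsto_const_nhds.div_atTop tendsto_id))
  rw [add_zero] at h
  refine h.congr' ?_
  filter_upwards [eventually_gt_atTop 0] with x hx
  rw [fluidSlope, ← Real.sqrt_div' _ hx.le]
  congr 1
  field_simp

/-- The limit of a squared affine function over an affine function times the variable. -/
lemma tendsto_sq_div_affine (a b : ℝ) :
    Tendsto (fun s : ℝ => (s + a) ^ 2 / (2 * (s + b)) / s) atTop (𝓝 (1 / 2)) := by
  have h0 (c : ℝ) : Tendsto (fun s : ℝ => 1 + c / s) atTop (𝓝 (1 + 0)) :=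
    tendsto_const_nhds.add (tendsto_const_nhds.div_atTop tendsto_id)
  have h : Tendsto (fun s : ℝ => (1 + a / s) ^ 2 / (2 * (1 + b / s))) atTop
      (𝓝 ((1 + 0) ^ 2 / (2 * (1 + 0)))) :=
    ((h0 a).pow 2).div ((h0 b).const_mul 2) (by norm_num)
  rw [show ((1 : ℝ) + 0) ^ 2 / (2 * (1 + 0)) = 1 / 2 by norm_num] at h
  refine h.congr' ?_
  filter_upwards [eventually_gt_atTop 0, eventually_gt_atTop (-b)] with s hs hb
  have : s + b ≠ 0 := by linarith
  have h1 : 1 + b / s = (s + b) / s := by field_simp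
  rw [h1]
  field_simp

lemma AssumptionA1.tendsto_bellmanError_div_sqrt (hA : AssumptionA1 P ℱ A) :
    Tendsto (fun x => bellmanError P A (fluidValue (meanArrival P A)) x / √x) atTop
      (𝓝 (1 / √2)) := by
  obtain ⟨N, hN, hbd⟩ := hA.exists_bound
  have hst := tendsto_fluidSlope (meanArrival P A)
  have key : Tendsto (fun x => bellmanError P A (fluidValue (meanArrival P A)) x /
      fluidSlope (meanArrival P A) x) atTop (𝓝 (1 / 2)) := by
    refine tendsto_of_tendsto_of_tendsto_of_le_of_le'
      ((tendsto_sq_div_affine 0 1).comp hst)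
      ((tendsto_sq_div_affine (meanArrival P A + N) (-2)).comp hst) ?_ ?_
    · filter_upwards [eventually_ge_atTop 0] with x hx
      simp only [Function.comp, add_zero]
      have := hA.le_bellmanError hx
      have := fluidSlope_nonneg (meanArrival P A) x
      gcongr
    · filter_upwards [eventually_ge_atTop 0,
        hst.eventually_ge_atTop (3 + meanArrival P A)] with x hx hs
      have h1 := hA.fluid_policy_le hN hbd hx hs
      have h2 := (hA.isLeast_bellmanError (continuous_fluidValue (meanArrival P A)) hx).2
        ⟨_, h1.1, rfl⟩
      simp only [Function.comp, ← add_assoc, ← sub_eq_add_neg]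
      have := fluidSlope_nonneg (meanArrival P A) x
      gcongr
      exact h2.trans h1.2
  have h := key.mul (tendsto_fluidSlope_div_sqrt (meanArrival P A))
  have e : 1 / 2 * √2 = 1 / √2 := by
    have : √2 ^ 2 = 2 := Real.sq_sqrt (by norm_num)
    field_simp
    linarith
  rw [e] at h
  refine h.congr' ?_
  filter_upwards [hst.eventually_gt_atTop 0] with x hs
  field_simp

lemma AssumptionA1.tendsto_bellmanError_div_cost (hA : AssumptionA1 P ℱ A) :
    Tendsto (fun x => bellmanError P A (fluidValue (meanArrival P A)) x / cost x 0) atTop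
      (𝓝 0) := by
  have h := hA.tendsto_bellmanError_div_sqrt.mul
    (tendsto_inv_atTop_zero.comp Real.tendsto_sqrt_atTop)
  rw [mul_zero] at h
  refine h.congr' ?_
  filter_upwards [eventually_gt_atTop 0] with x hx
  have h1 : cost x 0 = √x * √x := by rw [Real.mul_self_sqrt hx.le, cost]; ring
  have h2 : 0 < √x := Real.sqrt_pos.2 hx
  rw [h1, Function.comp]
  field_simp

end SpeedScaling

namespace SpeedScaling

variable {Ω : Type*} [mΩ : MeasurableSpace Ω] {P : Measure Ω} [IsProbabilityMeasure P]
  {ℱ : Filtration ℕ mΩ} {A : ℕ → Ω → ℝ}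

/-! ### Bounds from the optimality equation -/

namespace IsRelativeValueFunction

variable {η : ℝ} {h φ : ℝ → ℝ}

lemma le_of_feasible (hr : IsRelativeValueFunction P A η h φ) {x u : ℝ} (hu : u ∈ Set.Icc 0 x) :
    h x + η ≤ cost x u + ∫ ω, h (x - u + A 1 ω) ∂P := by
  have h1 := (hr.acoe x (hu.1.trans hu.2)).2 ⟨u, hu, rfl⟩
  simp only [generator_eq (hr.integrable _ (sub_nonneg.2 hu.2))] at h1
  linarith

/-- Serving down from `x` and from `y ≤ x` to the same level shows that `h(x) - x - x²/2` is
nonincreasing. Hence `h` is bounded on compact sets. -/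
lemma sub_quadratic_antitone (hr : IsRelativeValueFunction P A η h φ) {x y : ℝ} (hy : 0 ≤ y)
    (hyx : y ≤ x) : h x - x - x ^ 2 / 2 ≤ h y - y - y ^ 2 / 2 := by
  obtain ⟨v, hv, e⟩ := (hr.acoe y hy).1
  simp only [generator_eq (hr.integrable _ (sub_nonneg.2 hv.2))] at e
  have h1 := hr.le_of_feasible (x := x) (u := x - y + v) ⟨by linarith [hv.1], by linarith [hv.2]⟩
  rw [show x - (x - y + v) = y - v by ring] at h1
  unfold cost at *
  nlinarith [mul_nonneg (sub_nonneg.2 hyx) (sub_nonneg.2 hv.2)]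

/-- Along the fluid policy at large states, the mean decrease of `K + 4x` is at least the one-step
cost, and the state decreases by at least `1`; induction on the size of the state then bounds `h` by
`K + 4x` plus a constant. -/
lemma exists_le_fluidValue_add (hr : IsRelativeValueFunction P A η h φ)
    (hA : AssumptionA1 P ℱ A) (hη : 0 ≤ η) :
    ∃ B : ℝ, 0 ≤ B ∧ ∀ x, 0 ≤ x → h x ≤ fluidValue (meanArrival P A) x + 4 * x + B := by
  have hα := hA.meanArrival_nonneg
  set α := meanArrival P A with hαdef
  obtain ⟨N, hN, hbd⟩ := hA.exists_bound
  obtain ⟨M, hM⟩ := eventually_atTop.1 ((tendsto_fluidSlope α).eventually_ge_atTop (4 + α + N))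
  set L := max M 0 with hL
  have hL0 : 0 ≤ L := le_max_right _ _
  set B := max (h 0 + L + L ^ 2 / 2) 0 with hB
  have key : ∀ k : ℕ, ∀ x, 0 ≤ x → x ≤ L + k → h x ≤ fluidValue α x + 4 * x + B := by
    intro k
    induction k with
    | zero =>
      intro x hx hxL
      have h1 := hr.sub_quadratic_antitone le_rfl hx
      have h2 := fluidValue_nonneg hα hx
      have h3 : h 0 + L + L ^ 2 / 2 ≤ B := le_max_left _ _
      simp only [Nat.cast_zero, add_zero] at hxL
      nlinarith
    | succ k ih =>
      intro x hx hxL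
      rcases le_total x (L + k) with hk | hk
      · exact ih x hx hk
      have hs : 4 + α + N ≤ fluidSlope α x :=
        hM x ((le_max_left _ _).trans (le_trans (le_add_of_nonneg_right k.cast_nonneg) hk))
      obtain ⟨hu, hle⟩ := hA.fluid_policy_le hN hbd hx (by rw [← hαdef]; linarith)
      rw [← hαdef] at hu hle
      set s := fluidSlope α x with hsdef
      have hz : 0 ≤ x - (α + s) := sub_nonneg.2 hu.2
      have h1 := hr.le_of_feasible hu
      have hK := hA.integrable_continuous (continuous_fluidValue α) hz
      -- The drift of `4x` under `u = α + s` is `-4s`.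
      have hle4 : (s + α + N) ^ 2 / (2 * (s - 2)) ≤ 4 * s := by
        rw [div_le_iff₀ (by linarith)]
        nlinarith
      have h2 : ∫ ω, h (x - (α + s) + A 1 ω) ∂P ≤
          ∫ ω, (fluidValue α (x - (α + s) + A 1 ω) +
            (4 * (x - (α + s)) + B + 4 * (A 1 ω - 0))) ∂P := by
        refine integral_mono_ae (hr.integrable _ hz) (hK.add (hA.integrable_affine _ _ _)) ?_
        filter_upwards [hbd] with ω hω
        have := ih (x - (α + s) + A 1 ω) (add_nonneg hz hω.1) (by
          push_cast at hxL
          linarith [hω.2])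
        linarith
      rw [integral_add hK (hA.integrable_affine _ _ _), hA.integral_affine, ← hαdef] at h2
      rw [generator_eq hK] at hle
      linarith
  refine ⟨B, le_max_right _ _, fun x hx => ?_⟩
  obtain ⟨k, hk⟩ := exists_nat_ge x
  exact key k x hx (by linarith)

end IsRelativeValueFunction

end SpeedScaling

namespace SpeedScaling

variable {Ω : Type*}

/-! ### The return time -/

/-- The event `{τ₀ > n}` that there is no return to `0` up to time `n`. -/
def survival (X : ℕ → Ω → ℝ) (n : ℕ) : Set Ω := {ω | ∀ t, 1 ≤ t → t ≤ n → X t ω ≠ 0}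

lemma mem_survival_iff_lt_returnTime (X : ℕ → Ω → ℝ) (n : ℕ) (ω : Ω) :
    ω ∈ survival X n ↔ (n : ℕ∞) < returnTime X ω := by
  constructor
  · intro hω
    have h : ((n + 1 : ℕ) : ℕ∞) ≤ returnTime X ω := by
      refine le_iInf₂ fun t ht => ?_
      by_contra hlt
      have : t < n + 1 := by exact_mod_cast not_le.1 hlt
      exact hω t ht.1 (by omega) ht.2
    exact lt_of_lt_of_le (by exact_mod_cast n.lt_succ_self) h
  · intro h t ht htn h0
    have h1 : returnTime X ω ≤ (t : ℕ∞) := iInf₂_le t ⟨ht, h0⟩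
    exact absurd (h.trans_le h1) (not_lt.2 (by exact_mod_cast htn))

lemma survival_antitone (X : ℕ → Ω → ℝ) : Antitone (survival X) :=
  fun _ _ hmn _ hω t ht htm => hω t ht (htm.trans hmn)

lemma survival_zero (X : ℕ → Ω → ℝ) : survival X 0 = Set.univ := by
  refine Set.eq_univ_of_forall fun ω t ht ht0 => ?_
  omega

lemma eq_zero_of_mem_survival_diff {X : ℕ → Ω → ℝ} {n : ℕ} {ω : Ω}
    (hω : ω ∈ survival X n \ survival X (n + 1)) : X (n + 1) ω = 0 := by
  by_contra h
  refine hω.2 fun t ht htn => ?_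
  rcases Nat.lt_or_ge n t with h1 | h1
  · obtain rfl : t = n + 1 := by omega
    exact h
  · exact hω.1 t ht h1

lemma tsum_survival_indicator {X : ℕ → Ω → ℝ} {ω : Ω} (hω : returnTime X ω ≠ ⊤)
    (f : ℕ → Ω → ℝ≥0∞) :
    ∑' n, (survival X n).indicator (f n) ω =
      ∑ n ∈ Finset.range (returnTime X ω).toNat, f n ω := by
  have hiff (n : ℕ) : ω ∈ survival X n ↔ n < (returnTime X ω).toNat := by
    rw [mem_survival_iff_lt_returnTime]
    conv_lhs => rw [← ENat.natCast_toNat hω]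
    exact Nat.cast_lt
  rw [tsum_eq_sum (s := Finset.range (returnTime X ω).toNat)]
  · refine Finset.sum_congr rfl fun n hn => ?_
    rw [Set.indicator_of_mem ((hiff n).2 (Finset.mem_range.1 hn))]
  · intro n hn
    rw [Set.indicator_of_notMem]
    rwa [hiff, ← Finset.mem_range]

lemma coe_returnTime_eq_tsum (X : ℕ → Ω → ℝ) (ω : Ω) :
    (returnTime X ω : ℝ≥0∞) = ∑' n, (survival X n).indicator (fun _ => (1 : ℝ≥0∞)) ω := by
  by_cases hω : returnTime X ω = ⊤
  · have h (n : ℕ) : (survival X n).indicator (fun _ => (1 : ℝ≥0∞)) ω = 1 := by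
      rw [Set.indicator_of_mem]
      rw [mem_survival_iff_lt_returnTime, hω]
      exact ENat.natCast_lt_top n
    simp_rw [h]
    rw [ENNReal.tsum_const_eq_top_of_ne_zero one_ne_zero, hω]
    rfl
  · rw [tsum_survival_indicator hω fun _ _ => 1]
    conv_lhs => rw [← ENat.natCast_toNat hω]
    simp

variable [mΩ : MeasurableSpace Ω] {P : Measure Ω}
  {ℱ : Filtration ℕ mΩ} {A U : ℕ → Ω → ℝ} {x : ℝ}

/-! ### Verification of subsolutions -/

lemma IsControl.measurable_state (hU : IsControl P ℱ A x U) (hA : AssumptionA1 P ℱ A) (t : ℕ) :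
    Measurable[ℱ t] (state A U x t) := by
  induction t with
  | zero => exact measurable_const
  | succ t ih =>
    exact ((ih.mono (ℱ.mono t.le_succ) le_rfl).sub
      ((hU.adapted t).mono (ℱ.mono t.le_succ) le_rfl)).add (hA.measurable t)

lemma IsControl.measurableSet_survival (hU : IsControl P ℱ A x U) (hA : AssumptionA1 P ℱ A)
    (n : ℕ) : MeasurableSet[ℱ n] (survival (state A U x) n) := by
  have e : survival (state A U x) n =
      ⋂ t ∈ Finset.Icc 1 n, (state A U x t) ⁻¹' {0}ᶜ := by
    ext ω; simp [survival]
  rw [e]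
  refine Finset.measurableSet_biInter _ fun t ht => ?_
  exact (hU.measurable_state hA t).mono (ℱ.mono (Finset.mem_Icc.1 ht).2) le_rfl
    (measurableSet_singleton 0).compl

/-- Integrating out the next arrival, given the information `ℱ t`. -/
lemma AssumptionA1.setLIntegral_next [IsProbabilityMeasure P] (hA : AssumptionA1 P ℱ A) {t : ℕ}
    {Z : Ω → ℝ} (hZ : Measurable[ℱ t] Z) {S : Set Ω} (hS : MeasurableSet[ℱ t] S)
    {g : ℝ → ℝ≥0∞} (hg : Measurable g) :
    ∫⁻ ω in S, g (Z ω + A (t + 1) ω) ∂P =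
      ∫⁻ ω in S, (∫⁻ ω', g (Z ω + A 1 ω') ∂P) ∂P := by
  have hS' : MeasurableSet S := ℱ.le t _ hS
  have hZ' : Measurable Z := hZ.mono (ℱ.le t) le_rfl
  have hAt := hA.measurable_arrival t
  -- Pairing `Z` with the indicator of `S` turns the claim into Tonelli's theorem for the law of
  -- `(Y, A (t + 1))`, which is a product by independence.
  set Y : Ω → ℝ × ℝ≥0∞ := fun ω => (Z ω, S.indicator (fun _ => 1) ω) with hY
  have hYt : Measurable[ℱ t] Y :=
    Measurable.prodMk hZ (Measurable.indicator measurable_const hS)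
  have hY' : Measurable Y := hYt.mono (ℱ.le t) le_rfl
  have hind : IndepFun Y (A (t + 1)) P := by
    rw [IndepFun_iff_Indep]
    exact (indep_of_indep_of_le_right (hA.indep t) hYt.comap_le).symm
  have hmap := (indepFun_iff_map_prod_eq_prod_map_map hY'.aemeasurable hAt.aemeasurable).1 hind
  have hlaw : P.map (A (t + 1)) = P.map (A 1) := (hA.identDistrib t).map_eq
  have hf : Measurable fun p : (ℝ × ℝ≥0∞) × ℝ => p.1.2 * g (p.1.1 + p.2) := by fun_prop
  have hprob : IsProbabilityMeasure (P.map (A (t + 1))) :=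
    Measure.isProbabilityMeasure_map hAt.aemeasurable
  calc ∫⁻ ω in S, g (Z ω + A (t + 1) ω) ∂P
      = ∫⁻ ω, (fun p : (ℝ × ℝ≥0∞) × ℝ => p.1.2 * g (p.1.1 + p.2)) (Y ω, A (t + 1) ω) ∂P := by
        rw [← lintegral_indicator hS']
        refine lintegral_congr fun ω => ?_
        by_cases h : ω ∈ S <;> simp [hY, h]
    _ = ∫⁻ y, ∫⁻ a, y.2 * g (y.1 + a) ∂(P.map (A (t + 1))) ∂(P.map Y) := by
        rw [← lintegral_map hf (hY'.prodMk hAt), hmap, lintegral_prod _ hf.aemeasurable]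
    _ = ∫⁻ ω, ∫⁻ a, (Y ω).2 * g ((Y ω).1 + a) ∂(P.map (A 1)) ∂P := by
        rw [hlaw] at hprob ⊢
        exact lintegral_map (f := fun y : ℝ × ℝ≥0∞ => ∫⁻ a, y.2 * g (y.1 + a) ∂(P.map (A 1)))
          hf.lintegral_prod_right' hY'
    _ = _ := by
        rw [← lintegral_indicator hS']
        refine lintegral_congr fun ω => ?_
        rw [lintegral_const_mul _ (by fun_prop),
          lintegral_map (by fun_prop) (hA.measurable_arrival 0)]
        by_cases h : ω ∈ S <;> simp [hY, h]

/-- The expected cost incurred at time `n` before the return to `0`. -/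
noncomputable def survivalCost (P : Measure Ω) (A U : ℕ → Ω → ℝ) (x : ℝ) (n : ℕ) : ℝ≥0∞ :=
  ∫⁻ ω in survival (state A U x) n, ENNReal.ofReal (cost (state A U x n ω) (U n ω)) ∂P

/-- One step of the verification: a subsolution of the optimality equation, stopped at the return
to `0`, grows at most by the relative cost. -/
lemma IsControl.verification_step [IsProbabilityMeasure P] (hU : IsControl P ℱ A x U)
    (hA : AssumptionA1 P ℱ A) {η : ℝ} {g : ℝ → ℝ≥0∞} (hg : Measurable g)
    (hsub : ∀ y u, u ∈ Set.Icc 0 y → g y + ENNReal.ofReal η ≤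
      ENNReal.ofReal (cost y u) + ∫⁻ ω, g (y - u + A 1 ω) ∂P) (n : ℕ) :
    ∫⁻ ω in survival (state A U x) n, g (state A U x n ω) ∂P +
        ENNReal.ofReal η * P (survival (state A U x) n) ≤
      survivalCost P A U x n +
        (∫⁻ ω in survival (state A U x) (n + 1), g (state A U x (n + 1) ω) ∂P +
        g 0 * P (survival (state A U x) n \ survival (state A U x) (n + 1))) := by
  have hXn := hU.measurable_state hA n
  have hUn := hU.adapted n
  have hXn' : Measurable (state A U x n) := hXn.mono (ℱ.le n) le_rfl
  have hUn' : Measurable (U n) := hUn.mono (ℱ.le n) le_rfl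
  have hS := hU.measurableSet_survival hA n
  have hS1 : MeasurableSet (survival (state A U x) (n + 1)) :=
    ℱ.le _ _ (hU.measurableSet_survival hA (n + 1))
  have hS' : MeasurableSet (survival (state A U x) n) := ℱ.le _ _ hS
  have hc : Measurable fun ω => ENNReal.ofReal (cost (state A U x n ω) (U n ω)) := by
    unfold cost; fun_prop
  have hnext : ∫⁻ ω in survival (state A U x) n, g (state A U x (n + 1) ω) ∂P =
      ∫⁻ ω in survival (state A U x) (n + 1), g (state A U x (n + 1) ω) ∂P +
        g 0 * P (survival (state A U x) n \ survival (state A U x) (n + 1)) := by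
    rw [← lintegral_inter_add_sdiff _ _ hS1,
      Set.inter_eq_right.2 (survival_antitone _ n.le_succ), ← setLIntegral_const]
    congr 1
    refine setLIntegral_congr_fun (hS'.diff hS1) fun ω hω => ?_
    simp only [eq_zero_of_mem_survival_diff hω]
  rw [← hnext, ← setLIntegral_const, ← lintegral_add_right _ measurable_const]
  have hind := hA.setLIntegral_next (hXn.sub hUn) hS hg
  simp only [Pi.sub_apply] at hind
  have hstate : ∀ ω, state A U x (n + 1) ω = state A U x n ω - U n ω + A (n + 1) ω :=
    fun _ => rfl
  simp only [hstate]
  rw [hind, survivalCost, ← lintegral_add_left hc]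
  refine lintegral_mono_ae (ae_restrict_of_ae ?_)
  filter_upwards [hU.feasible n] with ω hω using hsub _ _ hω

lemma IsControl.verification_sum [IsProbabilityMeasure P] (hU : IsControl P ℱ A x U)
    (hA : AssumptionA1 P ℱ A) {η : ℝ} {g : ℝ → ℝ≥0∞} (hg : Measurable g)
    (hsub : ∀ y u, u ∈ Set.Icc 0 y → g y + ENNReal.ofReal η ≤
      ENNReal.ofReal (cost y u) + ∫⁻ ω, g (y - u + A 1 ω) ∂P) (n : ℕ) :
    g x + ENNReal.ofReal η * ∑ k ∈ Finset.range n, P (survival (state A U x) k) ≤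
      ∑ k ∈ Finset.range n, survivalCost P A U x k +
        (∫⁻ ω in survival (state A U x) n, g (state A U x n ω) ∂P +
        g 0 * P (survival (state A U x) n)ᶜ) := by
  induction n with
  | zero => simp [survival_zero, state]
  | succ n ih =>
    have hstep := hU.verification_step hA hg hsub n
    have hS1 : MeasurableSet (survival (state A U x) (n + 1)) :=
      ℱ.le _ _ (hU.measurableSet_survival hA (n + 1))
    have hS : MeasurableSet (survival (state A U x) n) :=
      ℱ.le _ _ (hU.measurableSet_survival hA n)
    have hcompl : P (survival (state A U x) (n + 1))ᶜ = P (survival (state A U x) n)ᶜ +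
        P (survival (state A U x) n \ survival (state A U x) (n + 1)) := by
      rw [← measure_union _ (hS.diff hS1)]
      · congr 1
        ext ω
        have := @survival_antitone _ (state A U x) _ _ n.le_succ ω
        simp only [Set.mem_compl_iff, Set.mem_union, Set.mem_sdiff]
        tauto
      · exact Set.disjoint_left.2 fun ω h1 h2 => h1 h2.1
    rw [Finset.sum_range_succ, Finset.sum_range_succ, hcompl, mul_add, mul_add]
    generalize ENNReal.ofReal η * P (survival (state A U x) n) = p at *
    generalize ENNReal.ofReal η * ∑ k ∈ Finset.range n, P (survival (state A U x) k) = q at *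
    generalize g 0 * P (survival (state A U x) n \ survival (state A U x) (n + 1)) = r at *
    generalize g 0 * P (survival (state A U x) n)ᶜ = r' at *
    generalize ∫⁻ ω in survival (state A U x) n, g (state A U x n ω) ∂P = a at *
    generalize ∫⁻ ω in survival (state A U x) (n + 1), g (state A U x (n + 1) ω) ∂P = a' at *
    generalize survivalCost P A U x n = c at *
    generalize ∑ k ∈ Finset.range n, survivalCost P A U x k = c' at *
    calc g x + (q + p) = (g x + q) + p := by ring
      _ ≤ (c' + (a + r')) + p := by gcongr
      _ = c' + r' + (a + p) := by ring
      _ ≤ c' + r' + (c + (a' + r)) := by gcongr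
      _ = _ := by ring

/-- Pathwise, the cost until the return to `0` is at least the fluid value function for zero
arrival rate: arrivals can only increase the remaining cost. This controls the boundary term in the
verification. -/
lemma IsControl.ae_fluidValue_le_tsum (hU : IsControl P ℱ A x U) (hA : AssumptionA1 P ℱ A)
    (hτ : ∀ᵐ ω ∂P, returnTime (state A U x) ω ≠ ⊤) (n : ℕ) :
    ∀ᵐ ω ∂P, (survival (state A U x) n).indicator
        (fun ω => ENNReal.ofReal (fluidValue 0 (state A U x n ω))) ω ≤
      ∑' k, (survival (state A U x) (k + n)).indicator
        (fun ω => ENNReal.ofReal (cost (state A U x (k + n) ω) (U (k + n) ω))) ω := by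
  have hA0 : ∀ᵐ ω ∂P, ∀ t, 0 ≤ A (t + 1) ω := by
    refine ae_all_iff.2 fun t => ?_
    have := (hA.identDistrib t).symm.ae_snd (p := fun y : ℝ => 0 ≤ y) measurableSet_Ici hA.nonneg
    exact this
  filter_upwards [hτ, hA0, ae_all_iff.2 hU.feasible] with ω hω hA0 hfeas
  set Kn : ℕ → ℝ≥0∞ := fun n => (survival (state A U x) n).indicator
    (fun ω => ENNReal.ofReal (fluidValue 0 (state A U x n ω))) ω with hKn
  set Cn : ℕ → ℝ≥0∞ := fun n => (survival (state A U x) n).indicator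
    (fun ω => ENNReal.ofReal (cost (state A U x n ω) (U n ω))) ω with hCn
  have hstep (n : ℕ) : Kn n ≤ Cn n + Kn (n + 1) := by
    by_cases hmem : ω ∈ survival (state A U x) n
    swap
    · simp [hKn, hmem]
    have hf := hfeas n
    have hx0 : 0 ≤ state A U x n ω := hf.1.trans hf.2
    have hz : 0 ≤ state A U x n ω - U n ω := sub_nonneg.2 hf.2
    have h1 := fluidValue_tangent_le 0 hx0 hz
    have h2 := cost_add_fluid_drift 0 (U n ω) hx0
    have h3 : fluidValue 0 (state A U x n ω - U n ω) ≤ fluidValue 0 (state A U x (n + 1) ω) :=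
      fluidValue_mono le_rfl hz (le_add_of_nonneg_right (hA0 n))
    have h4 : fluidValue 0 (state A U x n ω) ≤
        cost (state A U x n ω) (U n ω) + fluidValue 0 (state A U x (n + 1) ω) := by
      nlinarith [sq_nonneg (U n ω - 0 - fluidSlope 0 (state A U x n ω))]
    have h5 : Kn (n + 1) = ENNReal.ofReal (fluidValue 0 (state A U x (n + 1) ω)) := by
      by_cases hmem1 : ω ∈ survival (state A U x) (n + 1)
      · simp [hKn, hmem1]
      · rw [eq_zero_of_mem_survival_diff ⟨hmem, hmem1⟩, fluidValue_zero le_rfl]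
        simp [hKn, hmem1]
    rw [h5]
    simp only [hKn, hCn, Set.indicator_of_mem hmem]
    exact (ENNReal.ofReal_le_ofReal h4).trans ENNReal.ofReal_add_le
  have hsum (m : ℕ) : Kn n ≤ ∑ k ∈ Finset.range m, Cn (k + n) + Kn (m + n) := by
    induction m with
    | zero => simp
    | succ m ih =>
      rw [Finset.sum_range_succ, add_assoc, Nat.add_right_comm]
      exact ih.trans (by gcongr; exact hstep _)
  have hzero : Kn ((returnTime (state A U x) ω).toNat + n) = 0 := by
    simp only [hKn]
    rw [Set.indicator_of_notMem]
    rw [mem_survival_iff_lt_returnTime]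
    conv => enter [1, 2]; rw [← ENat.natCast_toNat hω]
    rw [Nat.cast_lt]
    omega
  have := hsum (returnTime (state A U x) ω).toNat
  rw [hzero, add_zero] at this
  exact this.trans (ENNReal.sum_le_tsum _)

/-- A subsolution of the optimality equation that grows at most like the fluid value function is a
lower bound for the expected relative cost up to the return to `0`. -/
lemma IsControl.verification [IsProbabilityMeasure P] (hU : IsControl P ℱ A x U)
    (hA : AssumptionA1 P ℱ A) {η : ℝ} {g : ℝ → ℝ≥0∞} (hg : Measurable g)
    (hsub : ∀ y u, u ∈ Set.Icc 0 y → g y + ENNReal.ofReal η ≤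
      ENNReal.ofReal (cost y u) + ∫⁻ ω, g (y - u + A 1 ω) ∂P)
    {D : ℝ≥0∞} (hD : D ≠ ⊤) (hgrow : ∀ y, 0 ≤ y → g y ≤ D * (1 + ENNReal.ofReal (fluidValue 0 y)))
    (hp : ∑' k, P (survival (state A U x) k) ≠ ⊤) (hc : ∑' k, survivalCost P A U x k ≠ ⊤)
    (hτ : ∀ᵐ ω ∂P, returnTime (state A U x) ω ≠ ⊤) :
    g x + ENNReal.ofReal η * ∑' k, P (survival (state A U x) k) ≤
      ∑' k, survivalCost P A U x k + g 0 := by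
  have hS (n : ℕ) : MeasurableSet (survival (state A U x) n) :=
    ℱ.le _ _ (hU.measurableSet_survival hA n)
  have hXm (n : ℕ) : Measurable (state A U x n) :=
    (hU.measurable_state hA n).mono (ℱ.le n) le_rfl
  have hUm (n : ℕ) : Measurable (U n) := (hU.adapted n).mono (ℱ.le n) le_rfl
  have hcm (n : ℕ) : Measurable fun ω => ENNReal.ofReal (cost (state A U x n ω) (U n ω)) := by
    have := hXm n
    have := hUm n
    unfold cost; fun_prop
  have hKm (n : ℕ) : Measurable fun ω => ENNReal.ofReal (fluidValue 0 (state A U x n ω)) :=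
    ((continuous_fluidValue 0).measurable.comp (hXm n)).ennreal_ofReal
  have hbound (n : ℕ) : ∫⁻ ω in survival (state A U x) n, g (state A U x n ω) ∂P ≤
      D * (P (survival (state A U x) n) + ∑' k, survivalCost P A U x (k + n)) := by
    calc _ ≤ ∫⁻ ω in survival (state A U x) n,
          D * (1 + ENNReal.ofReal (fluidValue 0 (state A U x n ω))) ∂P := by
          refine lintegral_mono_ae (ae_restrict_of_ae ?_)
          filter_upwards [hU.feasible n] with ω hω using hgrow _ (hω.1.trans hω.2)
      _ = D * (P (survival (state A U x) n) + ∫⁻ ω, (survival (state A U x) n).indicator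
            (fun ω => ENNReal.ofReal (fluidValue 0 (state A U x n ω))) ω ∂P) := by
          rw [lintegral_const_mul' _ _ hD,
            lintegral_add_left measurable_const, setLIntegral_one, lintegral_indicator (hS n)]
      _ ≤ D * (P (survival (state A U x) n) + ∫⁻ ω, ∑' k, (survival (state A U x) (k + n)).indicator
            (fun ω => ENNReal.ofReal (cost (state A U x (k + n) ω) (U (k + n) ω))) ω ∂P) := by
          gcongr D * (_ + ?_)
          exact lintegral_mono_ae (hU.ae_fluidValue_le_tsum hA hτ n)
      _ = _ := by
          rw [lintegral_tsum fun k => ((hcm _).indicator (hS _)).aemeasurable]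
          simp_rw [lintegral_indicator (hS _)]
          rfl
  have hlim : Tendsto (fun n => ∑' k, survivalCost P A U x k +
      (D * (P (survival (state A U x) n) + ∑' k, survivalCost P A U x (k + n)) + g 0)) atTop
      (𝓝 (∑' k, survivalCost P A U x k + (D * (0 + 0) + g 0))) :=
    tendsto_const_nhds.add (((ENNReal.Tendsto.const_mul
      ((ENNReal.tendsto_atTop_zero_of_tsum_ne_top hp).add (ENNReal.tendsto_sum_nat_add _ hc))
      (Or.inr hD))).add tendsto_const_nhds)
  simp only [add_zero, mul_zero, zero_add] at hlim
  have hlim' : Tendsto (fun n => g x + ENNReal.ofReal η *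
      ∑ k ∈ Finset.range n, P (survival (state A U x) k)) atTop
      (𝓝 (g x + ENNReal.ofReal η * ∑' k, P (survival (state A U x) k))) :=
    tendsto_const_nhds.add (ENNReal.Tendsto.const_mul
      (ENNReal.tendsto_nat_tsum _) (Or.inr ENNReal.ofReal_ne_top))
  refine le_of_tendsto_of_tendsto' hlim' hlim fun n => ?_
  refine (hU.verification_sum hA hg hsub n).trans ?_
  gcongr
  · exact ENNReal.sum_le_tsum _
  · exact hbound n
  · exact (mul_le_mul_right prob_le_one _).trans_eq (mul_one _)

end SpeedScaling

namespace SpeedScaling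

variable {Ω : Type*} [mΩ : MeasurableSpace Ω] {P : Measure Ω}
  {ℱ : Filtration ℕ mΩ} {A : ℕ → Ω → ℝ}

/-! ### The direct error -/

/-- For a control with `E[τ₀] < ∞` and finite expected relative cost, the costs and the survival
probabilities before the return to `0` sum to the expected cost and to `E[τ₀]`. -/
lemma IsControl.tsum_survivalCost {U : ℕ → Ω → ℝ} {x : ℝ} (hU : IsControl P ℱ A x U)
    (hA : AssumptionA1 P ℱ A) {η : ℝ}
    (hτ : ∫⁻ ω, (returnTime (state A U x) ω : ℝ≥0∞) ∂P < ⊤)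
    (hcyc : Integrable (cycleCost A U η x) P) :
    (∀ᵐ ω ∂P, returnTime (state A U x) ω ≠ ⊤) ∧ ∃ T : ℝ, 0 ≤ T ∧
      0 ≤ (∫ ω, cycleCost A U η x ω ∂P) + η * T ∧
      ∑' k, P (survival (state A U x) k) = ENNReal.ofReal T ∧
      ∑' k, survivalCost P A U x k =
        ENNReal.ofReal ((∫ ω, cycleCost A U η x ω ∂P) + η * T) := by
  have hS (n : ℕ) : MeasurableSet (survival (state A U x) n) :=
    ℱ.le _ _ (hU.measurableSet_survival hA n)
  have hcm (n : ℕ) : Measurable fun ω => ENNReal.ofReal (cost (state A U x n ω) (U n ω)) := by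
    have : Measurable (state A U x n) := (hU.measurable_state hA n).mono (ℱ.le n) le_rfl
    have : Measurable (U n) := (hU.adapted n).mono (ℱ.le n) le_rfl
    unfold cost; fun_prop
  have hτm : Measurable fun ω => (returnTime (state A U x) ω : ℝ≥0∞) := by
    simp_rw [coe_returnTime_eq_tsum]
    exact Measurable.tsum fun n => measurable_const.indicator (hS n)
  have hfin : ∀ᵐ ω ∂P, returnTime (state A U x) ω ≠ ⊤ := by
    filter_upwards [ae_lt_top hτm hτ.ne] with ω hω he
    rw [he] at hω
    exact absurd hω (by simp)
  have hTi : Integrable (fun ω => (returnTime (state A U x) ω : ℝ≥0∞).toReal) P :=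
    integrable_toReal_of_lintegral_ne_top hτm.aemeasurable hτ.ne
  have hTint : ∫ ω, (returnTime (state A U x) ω : ℝ≥0∞).toReal ∂P =
      (∫⁻ ω, (returnTime (state A U x) ω : ℝ≥0∞) ∂P).toReal :=
    integral_toReal hτm.aemeasurable (ae_lt_top hτm hτ.ne)
  have hTsum : ∑' k, P (survival (state A U x) k) =
      ∫⁻ ω, (returnTime (state A U x) ω : ℝ≥0∞) ∂P := by
    simp_rw [coe_returnTime_eq_tsum]
    rw [lintegral_tsum fun n => (measurable_const.indicator (hS n)).aemeasurable]
    simp_rw [lintegral_indicator (hS _), setLIntegral_one]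
  have hCsum : ∑' k, survivalCost P A U x k = ∫⁻ ω, ∑' k, (survival (state A U x) k).indicator
      (fun ω => ENNReal.ofReal (cost (state A U x k ω) (U k ω))) ω ∂P := by
    rw [lintegral_tsum fun n => ((hcm n).indicator (hS n)).aemeasurable]
    simp_rw [lintegral_indicator (hS _)]
    rfl
  have hcost : ∀ᵐ ω ∂P, ∀ k, 0 ≤ cost (state A U x k ω) (U k ω) := by
    filter_upwards [ae_all_iff.2 hU.feasible] with ω hω k
    have := (hω k).1.trans (hω k).2
    unfold cost
    positivity
  have htotal : ∀ᵐ ω ∂P, cycleCost A U η x ω + η * (returnTime (state A U x) ω : ℝ≥0∞).toReal =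
      ∑ k ∈ Finset.range (returnTime (state A U x) ω).toNat,
        cost (state A U x k ω) (U k ω) := by
    filter_upwards [hfin] with ω hω
    have e : (returnTime (state A U x) ω : ℝ≥0∞).toReal =
        ((returnTime (state A U x) ω).toNat : ℝ) := by
      conv_lhs => rw [← ENat.natCast_toNat hω]
      simp
    rw [e, cycleCost, Finset.sum_sub_distrib]
    simp
    ring
  have hint : Integrable (fun ω => cycleCost A U η x ω +
      η * (returnTime (state A U x) ω : ℝ≥0∞).toReal) P := hcyc.add (hTi.const_mul η)
  have hnn : ∀ᵐ ω ∂P, 0 ≤ cycleCost A U η x ω +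
      η * (returnTime (state A U x) ω : ℝ≥0∞).toReal := by
    filter_upwards [htotal, hcost] with ω e hc
    rw [e]
    exact Finset.sum_nonneg fun k _ => hc k
  have hval : ∫ ω, (cycleCost A U η x ω + η * (returnTime (state A U x) ω : ℝ≥0∞).toReal) ∂P =
      (∫ ω, cycleCost A U η x ω ∂P) +
        η * (∫⁻ ω, (returnTime (state A U x) ω : ℝ≥0∞) ∂P).toReal := by
    rw [integral_add hcyc (hTi.const_mul η), integral_const_mul, hTint]
  refine ⟨hfin, (∫⁻ ω, (returnTime (state A U x) ω : ℝ≥0∞) ∂P).toReal, ENNReal.toReal_nonneg,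
    ?_, ?_, ?_⟩
  · rw [← hval]
    exact integral_nonneg_of_ae hnn
  · rw [ENNReal.ofReal_toReal hτ.ne, hTsum]
  · rw [← hval, ofReal_integral_eq_lintegral_ofReal hint hnn, hCsum]
    refine lintegral_congr_ae ?_
    filter_upwards [htotal, hcost, hfin] with ω e hc hω
    rw [e, tsum_survival_indicator hω, ENNReal.ofReal_sum_of_nonneg fun k _ => hc k]

variable [IsProbabilityMeasure P]

/-- The fluid value function is a subsolution of the optimality equation at large states, where its
Bellman error exceeds `η`; a shift of `h` dominates it at small states. Hence the maximum of the two
is a subsolution everywhere. -/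
lemma IsRelativeValueFunction.exists_subsolution {η : ℝ} {h φ : ℝ → ℝ}
    (hr : IsRelativeValueFunction P A η h φ) (hA : AssumptionA1 P ℱ A) (hη : 0 ≤ η) :
    ∃ C : ℝ, 0 ≤ C ∧ ∀ y u, u ∈ Set.Icc 0 y →
      max (h y + C) (fluidValue (meanArrival P A) y) + η ≤ cost y u +
        ∫ ω, max (h (y - u + A 1 ω) + C) (fluidValue (meanArrival P A) (y - u + A 1 ω)) ∂P := by
  have hα := hA.meanArrival_nonneg
  obtain ⟨M, hM⟩ := eventually_atTop.1
    ((tendsto_fluidSlope (meanArrival P A)).eventually_ge_atTop (4 * η + 1))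
  set L := max M 0 with hL
  have hL0 : 0 ≤ L := le_max_right _ _
  set C := max (fluidValue (meanArrival P A) L - h L + L + L ^ 2 / 2) 0 with hC
  refine ⟨C, le_max_right _ _, fun y u hu => ?_⟩
  have hy : 0 ≤ y := hu.1.trans hu.2
  have hz : 0 ≤ y - u := sub_nonneg.2 hu.2
  have hih : Integrable (fun ω => h (y - u + A 1 ω) + C) P :=
    (hr.integrable _ hz).add (integrable_const _)
  have hiK := hA.integrable_continuous (continuous_fluidValue (meanArrival P A)) hz
  have hmax := hih.sup hiK
  have h1 : h y + C + η ≤ cost y u +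
      ∫ ω, max (h (y - u + A 1 ω) + C) (fluidValue (meanArrival P A) (y - u + A 1 ω)) ∂P := by
    have e := hr.le_of_feasible hu
    have e2 : ∫ ω, (h (y - u + A 1 ω) + C) ∂P = (∫ ω, h (y - u + A 1 ω) ∂P) + C := by
      rw [integral_add (hr.integrable _ hz) (integrable_const _)]; simp
    have e3 := integral_mono hih hmax fun ω => le_max_left _ _
    simp only [Pi.sup_apply] at e3
    linarith
  rcases le_total y L with hyL | hyL
  · have e1 := hr.sub_quadratic_antitone hy hyL
    have e2 := fluidValue_mono hα hy hyL
    have e3 : fluidValue (meanArrival P A) L - h L + L + L ^ 2 / 2 ≤ C := le_max_left _ _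
    have e4 : fluidValue (meanArrival P A) y ≤ h y + C := by nlinarith
    rwa [max_eq_left e4]
  · have h2 : fluidValue (meanArrival P A) y + η ≤ cost y u +
        ∫ ω, max (h (y - u + A 1 ω) + C) (fluidValue (meanArrival P A) (y - u + A 1 ω)) ∂P := by
      have e1 := hA.le_cost_add_generator hu
      rw [generator_eq hiK] at e1
      have e3 := integral_mono hiK hmax fun ω => le_max_right _ _
      simp only [Pi.sup_apply] at e3
      have hs : 4 * η + 1 ≤ fluidSlope (meanArrival P A) y := hM y ((le_max_left _ _).trans hyL)
      have e4 : η ≤ fluidSlope (meanArrival P A) y ^ 2 /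
          (2 * (fluidSlope (meanArrival P A) y + 1)) := by
        rw [le_div_iff₀ (by linarith)]
        nlinarith
      linarith
    rcases max_cases (h y + C) (fluidValue (meanArrival P A) y) with ⟨e, _⟩ | ⟨e, _⟩ <;> rw [e]
    · exact h1
    · exact h2

/-- Verification of the subsolution `max (h + C) K` along an optimal control of the stochastic
shortest path problem. -/
lemma IsRelativeValueFunction.exists_fluidValue_sub_le {η : ℝ} {h φ : ℝ → ℝ}
    (hr : IsRelativeValueFunction P A η h φ) (hA : AssumptionA1 P ℱ A) (hη : 0 ≤ η)
    (hssp : HasSSPRepresentation P ℱ A η h) :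
    ∃ b : ℝ, 0 ≤ b ∧ ∀ x, 0 ≤ x → fluidValue (meanArrival P A) x - b ≤ h x := by
  have hα := hA.meanArrival_nonneg
  obtain ⟨C, hC, hsub⟩ := hr.exists_subsolution hA hη
  obtain ⟨B, hB, hup⟩ := hr.exists_le_fluidValue_add hA hη
  obtain ⟨D, hD, hgrow⟩ := exists_fluidValue_add_affine_le (b := 4) (c := B + C) hα
    (by norm_num) (add_nonneg hB hC)
  set g : ℝ → ℝ := fun y => max (h y + C) (fluidValue (meanArrival P A) y) with hg
  have hgm : Measurable g :=
    (hr.measurable.add measurable_const).max (continuous_fluidValue _).measurable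
  have hg0 (y : ℝ) (hy : 0 ≤ y) : 0 ≤ g y := le_max_of_le_right (fluidValue_nonneg hα hy)
  refine ⟨g 0, hg0 0 le_rfl, fun x hx => ?_⟩
  obtain ⟨U, hU, hτ, hcyc, hval⟩ := (hssp x hx).1
  obtain ⟨hfin, T, hT, hCT, hp, hc⟩ := hU.tsum_survivalCost hA hτ hcyc
  have hver := hU.verification hA (η := η) (g := fun y => ENNReal.ofReal (g y))
    hgm.ennreal_ofReal (fun y u hu => ?_) (D := ENNReal.ofReal D) ENNReal.ofReal_ne_top
    (fun y hy => ?_) (hp ▸ ENNReal.ofReal_ne_top) (hc ▸ ENNReal.ofReal_ne_top) hfin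
  · rw [hp, hc, ← hval, ← ENNReal.ofReal_mul hη,
      ← ENNReal.ofReal_add (hg0 x hx) (mul_nonneg hη hT),
      ← ENNReal.ofReal_add (hval ▸ hCT) (hg0 0 le_rfl),
      ENNReal.ofReal_le_ofReal_iff (add_nonneg (hval ▸ hCT) (hg0 0 le_rfl))] at hver
    have : fluidValue (meanArrival P A) x ≤ g x := le_max_right _ _
    linarith
  · have hy : 0 ≤ y := hu.1.trans hu.2
    have hz : 0 ≤ y - u := sub_nonneg.2 hu.2
    have hig : Integrable (fun ω => g (y - u + A 1 ω)) P :=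
      ((hr.integrable _ hz).add (integrable_const C)).sup
        (hA.integrable_continuous (continuous_fluidValue _) hz)
    have hnn : ∀ᵐ ω ∂P, 0 ≤ g (y - u + A 1 ω) := by
      filter_upwards [hA.nonneg] with ω hω using hg0 _ (add_nonneg hz hω)
    rw [← ofReal_integral_eq_lintegral_ofReal hig hnn, ← ENNReal.ofReal_add (hg0 y hy) hη]
    exact (ENNReal.ofReal_le_ofReal (hsub y u hu)).trans ENNReal.ofReal_add_le
  · have hK0 := fluidValue_nonneg le_rfl hy
    rw [← ENNReal.ofReal_one, ← ENNReal.ofReal_add zero_le_one hK0, ← ENNReal.ofReal_mul hD]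
    refine ENNReal.ofReal_le_ofReal (le_trans ?_ (hgrow y hy))
    have := hup y hy
    refine max_le ?_ ?_ <;> linarith

/-- A function of at most linear growth is negligible relative to the fluid value function. -/
lemma tendsto_div_fluidValue_zero {α b c : ℝ} (hα : 0 ≤ α) {f : ℝ → ℝ}
    (hc : 0 ≤ c) (hf : ∀ x, 0 ≤ x → |f x| ≤ b * x + c) :
    Tendsto (fun x => f x / fluidValue α x) atTop (𝓝 0) := by
  have hr : Tendsto (fun x : ℝ => √(2 * x)) atTop atTop :=
    Real.tendsto_sqrt_atTop.comp (tendsto_id.const_mul_atTop (by norm_num))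
  refine squeeze_zero_norm' (a := fun x => (b + c) * (3 / 2) / √(2 * x)) ?_
    (tendsto_const_nhds.div_atTop hr)
  filter_upwards [eventually_ge_atTop 1] with x hx
  have hx0 : 0 ≤ x := by linarith
  have h1 := sqrt_cube_le_fluidValue hα hx0
  have h2 : √(2 * x) ^ 2 = 2 * x := Real.sq_sqrt (by positivity)
  have h3 : 0 < √(2 * x) := Real.sqrt_pos.2 (by linarith)
  have h4 : |f x| ≤ (b + c) * x := (hf x hx0).trans (by nlinarith)
  have h5 : 0 < √(2 * x) ^ 3 / 3 := by positivity
  rw [norm_div, Real.norm_eq_abs, Real.norm_of_nonneg (h5.le.trans h1)]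
  calc |f x| / fluidValue α x ≤ (b + c) * x / (√(2 * x) ^ 3 / 3) :=
        div_le_div₀ ((abs_nonneg _).trans h4) h4 h5 h1
    _ = (b + c) * (√(2 * x) ^ 2 / 2) / (√(2 * x) ^ 3 / 3) := by rw [h2]; ring
    _ = _ := by field_simp

end SpeedScaling

theorem mainTheorem1 {Ω : Type*} [mΩ : MeasurableSpace Ω] (P : Measure Ω) [IsProbabilityMeasure P]
    (ℱ : Filtration ℕ mΩ) (A : ℕ → Ω → ℝ) (α : ℝ) (K : ℝ → ℝ)
    (hA : SpeedScaling.AssumptionA1 P ℱ A)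
    (hα : α = SpeedScaling.meanArrival P A)
    (hK : K = SpeedScaling.fluidValue α) :
    ((∀ x, 0 ≤ x →
        IsLeast (SpeedScaling.bellmanValues P A K x) (SpeedScaling.bellmanError P A K x) ∧
        0 ≤ SpeedScaling.bellmanError P A K x) ∧
      Tendsto (fun x => SpeedScaling.bellmanError P A K x / √x) atTop (𝓝 (1 / √2)) ∧
      Tendsto (fun x => SpeedScaling.bellmanError P A K x / SpeedScaling.cost x 0) atTop (𝓝 0)) ∧
    ∀ (ηstar : ℝ) (hstar φstar : ℝ → ℝ),
      SpeedScaling.IsOptimalAverageCost P ℱ A ηstar →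
      SpeedScaling.IsRelativeValueFunction P A ηstar hstar φstar →
      SpeedScaling.AssumptionA2 P ℱ A ηstar hstar φstar →
      (∃ b₀ b₁ b₂ : ℝ, ∀ x, 0 ≤ x →
        -b₀ ≤ hstar x - K x ∧ hstar x - K x ≤ b₁ * x + b₂) ∧
      Tendsto (fun x => (hstar x - K x) / K x) atTop (𝓝 0) := by
  subst hα hK
  refine ⟨⟨fun x hx => ⟨hA.isLeast_bellmanError (SpeedScaling.continuous_fluidValue _) hx,
    le_trans ?_ (hA.le_bellmanError hx)⟩, hA.tendsto_bellmanError_div_sqrt,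
    hA.tendsto_bellmanError_div_cost⟩, fun η h φ hη hr hA2 => ?_⟩
  · have := SpeedScaling.fluidSlope_nonneg (SpeedScaling.meanArrival P A) x
    positivity
  obtain ⟨B, hB, hup⟩ := hr.exists_le_fluidValue_add hA hη.1
  obtain ⟨b, hb, hlow⟩ := hr.exists_fluidValue_sub_le hA hη.1 hA2.ssp
  refine ⟨⟨b, 4, B, fun x hx => ⟨by linarith [hlow x hx], by linarith [hup x hx]⟩⟩, ?_⟩
  refine SpeedScaling.tendsto_div_fluidValue_zero (b := 4) (c := B + b) hA.meanArrival_nonneg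
    (add_nonneg hB hb) fun x hx => abs_le.2 ⟨?_, ?_⟩ <;> linarith [hlow x hx, hup x hx]
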